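/- Let $A\in\mathbb{R}^{n\times n}$, $B\in\mathbb{R}^{n\times m}$, $S\in\mathbb{R}^{m\times n}$, and let $Q\in\mathbb{R}^{n\times n}$ and $R\in\mathbb{R}^{m\times m}$ be symmetric. Assume that: (i) $(A,B)$ is controllable, i.e. $\operatorname{rank}[\,B\ \ AB\ \cdots\ A^{n-1}B\,]=n$; (ii) quadratic strict $(x,u)$-pre-dissipativity holds, i.e. there are a matrix $\Lambda\in\mathbb{R}^{n\times n}$ and a scalar $\epsilon>0$ such that for all $x\in\mathbb{R}^n$ and $u\in\mathbb{R}^m$ $$\begin{pmatrix}x\\u\end{pmatrix}^{\!\top}\begin{pmatrix}Q+\Lambda-A^\top\Lambda A & S^\top-A^\top\Lambda B\\ S-B^\top\Lambda A & R-B^\top\Lambda B\end{pmatrix}\begin{pmatrix}x\\u\end{pmatrix}\ \ge\ \epsilon\,(\|x\|^2+\|u\|^2).$$ Let $\hat K\in\mathbb{R}^{m\times n}$ be any matrix such that $A_{\hat K}:=A-B\hat K$ is invertible, put $S_{\hat K}:=S-R\hat K$, and assume that $D:=R-S_{\hat K}A_{\hat K}^{-1}B$ is invertible. Then the antistabilizing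 solution of the discrete algebraic Riccati equation (DARE) exists. That is, there is exactly one symmetric matrix $P\in\mathbb{R}^{n\times n}$ such that $R+B^\top PB$ is invertible and, with $K:=(R+B^\top PB)^{-1}(S+B^\top PA)$, $$P=Q+A^\top PA-(S^\top+A^\top PB)K,$$ and every eigenvalue $\mu\in\mathbb{C}$ of $A-BK$ satisfies $|\mu|>1$. -/

import Mathlib

open Matrix

noncomputable section

/-- `(A, B)` is controllable: the controllability matrix `[B, AB, …, A ^ (n - 1) B]`
has full row rank. -/
def IsControllable {n m : ℕ} (A : Matrix (Fin n) (Fin n) ℝ) (B : Matrix (Fin n) (Fin m) ℝ) :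
    Prop :=
  (Matrix.of fun (i : Fin n) (p : Fin n × Fin m) => (A ^ (p.1 : ℕ) * B) i p.2).rank = n

/-- The stage cost matrix `H_Λ` rotated by the storage function `λ(x) = xᵀ Λ x`. -/
def rotatedCost {n m : ℕ} (A : Matrix (Fin n) (Fin n) ℝ) (B : Matrix (Fin n) (Fin m) ℝ)
    (Q : Matrix (Fin n) (Fin n) ℝ) (S : Matrix (Fin m) (Fin n) ℝ) (R : Matrix (Fin m) (Fin m) ℝ)
    (L : Matrix (Fin n) (Fin n) ℝ) : Matrix (Fin n ⊕ Fin m) (Fin n ⊕ Fin m) ℝ :=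
  Matrix.fromBlocks (Q + L - Aᵀ * L * A) (Sᵀ - Aᵀ * L * B)
    (S - Bᵀ * L * A) (R - Bᵀ * L * B)

/-- Quadratic strict `(x, u)`-pre-dissipativity: for some storage matrix `L` and some `ε > 0`,
the rotated stage cost is at least `ε (‖x‖² + ‖u‖²)` (Euclidean norms; `x ⬝ᵥ x = ‖x‖²`). -/
def QuadStrictPreDissipative {n m : ℕ} (A : Matrix (Fin n) (Fin n) ℝ)
    (B : Matrix (Fin n) (Fin m) ℝ) (Q : Matrix (Fin n) (Fin n) ℝ) (S : Matrix (Fin m) (Fin n) ℝ)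
    (R : Matrix (Fin m) (Fin m) ℝ) : Prop :=
  ∃ L : Matrix (Fin n) (Fin n) ℝ, ∃ ε : ℝ, 0 < ε ∧
    ∀ (x : Fin n → ℝ) (u : Fin m → ℝ),
      ε * (x ⬝ᵥ x + u ⬝ᵥ u) ≤
        Sum.elim x u ⬝ᵥ (rotatedCost A B Q S R L *ᵥ Sum.elim x u)

/-- The feedback matrix `K = (R + Bᵀ P B)⁻¹ (S + Bᵀ P A)` associated with `P`. -/
def dareGain {n m : ℕ} (A : Matrix (Fin n) (Fin n) ℝ) (B : Matrix (Fin n) (Fin m) ℝ)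
    (S : Matrix (Fin m) (Fin n) ℝ) (R : Matrix (Fin m) (Fin m) ℝ)
    (P : Matrix (Fin n) (Fin n) ℝ) : Matrix (Fin m) (Fin n) ℝ :=
  (R + Bᵀ * P * B)⁻¹ * (S + Bᵀ * P * A)

/-- `P` is a (symmetric) solution of the discrete algebraic Riccati equation; the inverse
occurring in the equation is required to exist. -/
structure IsDARESolution {n m : ℕ} (A : Matrix (Fin n) (Fin n) ℝ) (B : Matrix (Fin n) (Fin m) ℝ)
    (Q : Matrix (Fin n) (Fin n) ℝ) (S : Matrix (Fin m) (Fin n) ℝ) (R : Matrix (Fin m) (Fin m) ℝ)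
    (P : Matrix (Fin n) (Fin n) ℝ) : Prop where
  symm : P.IsSymm
  isUnit : IsUnit (R + Bᵀ * P * B)
  eq : P = Q + Aᵀ * P * A - (Sᵀ + Aᵀ * P * B) * dareGain A B S R P

/-- `P` is an antistabilizing solution of the discrete algebraic Riccati equation: all complex
eigenvalues of the closed-loop matrix `A - B K` lie strictly outside the unit circle. -/
structure IsAntistabilizingDARESolution {n m : ℕ} (A : Matrix (Fin n) (Fin n) ℝ)
    (B : Matrix (Fin n) (Fin m) ℝ) (Q : Matrix (Fin n) (Fin n) ℝ) (S : Matrix (Fin m) (Fin n) ℝ)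
    (R : Matrix (Fin m) (Fin m) ℝ) (P : Matrix (Fin n) (Fin n) ℝ) : Prop where
  solution : IsDARESolution A B Q S R P
  outside : ∀ μ ∈ spectrum ℂ ((A - B * dareGain A B S R P).map (fun t : ℝ => (t : ℂ))), 1 < ‖μ‖

end

/-! Symmetrizing the storage matrix to `L` and rotating the cost makes the stage cost `H` positive
definite; a DARE solution `P` for the rotated data gives `P - L` for the original data, with the
same gain.

For such `H`, optimal control is run backwards: the least cost `yᵀVy` of arriving at `y` from a free
initial state minimizes stage cost plus `xᵀVx` over `Ax + Bu = y`. Value iteration from `0`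
increases and controllability bounds it, so it converges to a fixed point `V > 0`. If `y ↦ (Fy, Uy)`
is the minimizer, the Lagrange conditions say that `-V` solves the DARE with gain `-UF⁻¹` and closed
loop `F⁻¹`; invertibility of `D` makes `F` and `R - BᵀVB` invertible. The fixed-point identity
becomes `F⁻ᵀVF⁻¹ = V + W` with `W > 0`, which forces antistability (`one_lt_norm_of_stein`).

Two antistabilizing solutions differ by some `X = NᵀXM` with `N`, `M` their closed loops, hence `X =
0`. -/

theorem mulVec_dotProduct_eq {ι κ : Type*} [Fintype ι] [Fintype κ] (Z : Matrix ι κ ℝ) (x : κ → ℝ)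
    (w : ι → ℝ) : (Z *ᵥ x) ⬝ᵥ w = x ⬝ᵥ (Zᵀ *ᵥ w) := by
  rw [dotProduct_mulVec, vecMul_transpose]

theorem isSymm_of_posDef {ι : Type*} {G : Matrix ι ι ℝ} (hG : G.PosDef) : Gᵀ = G := by
  simpa using hG.isHermitian.eq

/-! ### Quadratic minimization under a linear constraint -/

section ConstrainedMinimum

variable {ι κ : Type*} [Fintype ι] [Fintype κ] [DecidableEq ι] [DecidableEq κ]

/-- The matrix of the value function `y ↦ min {zᵀ G z | C z = y}`. -/
noncomputable def minCost (G : Matrix ι ι ℝ) (C : Matrix κ ι ℝ) : Matrix κ κ ℝ :=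
  (C * G⁻¹ * Cᵀ)⁻¹

/-- The matrix sending `y` to the minimizer of `zᵀ G z` subject to `C z = y`. -/
noncomputable def minArg (G : Matrix ι ι ℝ) (C : Matrix κ ι ℝ) : Matrix ι κ ℝ :=
  G⁻¹ * Cᵀ * minCost G C

variable {G : Matrix ι ι ℝ} {C : Matrix κ ι ℝ} {W : Matrix ι κ ℝ}

theorem posDef_mul_inv_mul_transpose (hG : G.PosDef) (hC : C * W = 1) :
    (C * G⁻¹ * Cᵀ).PosDef := by
  have := hG.inv.mul_mul_conjTranspose_same (B := C) (by
    intro x y h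
    have h' := congrArg (fun v => v ᵥ* W) h
    simpa [vecMul_vecMul, hC] using h')
  simpa using this

theorem minCost_posDef (hG : G.PosDef) (hC : C * W = 1) : (minCost G C).PosDef :=
  (posDef_mul_inv_mul_transpose hG hC).inv

theorem mul_minArg_eq_one (hG : G.PosDef) (hC : C * W = 1) : C * minArg G C = 1 := by
  have h := (posDef_mul_inv_mul_transpose hG hC).isUnit
  rw [isUnit_iff_isUnit_det] at h
  rw [minArg, ← Matrix.mul_assoc, ← Matrix.mul_assoc, minCost, Matrix.mul_nonsing_inv _ h]

/-- Stationarity condition: `minCost G C *ᵥ y` is the Lagrange multiplier of the constraint `C z =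
y`. -/
theorem mul_minArg (hG : G.PosDef) : G * minArg G C = Cᵀ * minCost G C := by
  have h := hG.isUnit
  rw [isUnit_iff_isUnit_det] at h
  rw [minArg, Matrix.mul_assoc, ← Matrix.mul_assoc, Matrix.mul_nonsing_inv _ h, Matrix.one_mul]

theorem transpose_minArg_mul (hG : G.PosDef) (hC : C * W = 1) :
    (minArg G C)ᵀ * G = minCost G C * C := by
  have := congrArg transpose (mul_minArg (C := C) hG)
  simpa [isSymm_of_posDef hG, isSymm_of_posDef (minCost_posDef hG hC)] using this

theorem transpose_minArg_mul_mul (hG : G.PosDef) (hC : C * W = 1) :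
    (minArg G C)ᵀ * G * minArg G C = minCost G C := by
  rw [transpose_minArg_mul hG hC, Matrix.mul_assoc, mul_minArg_eq_one hG hC, Matrix.mul_one]

theorem minCost_eq (hG : G.PosDef) (hC : C * W = 1) (y : κ → ℝ) :
    (minArg G C *ᵥ y) ⬝ᵥ (G *ᵥ (minArg G C *ᵥ y)) = y ⬝ᵥ (minCost G C *ᵥ y) := by
  rw [mulVec_dotProduct_eq, mulVec_mulVec, mulVec_mulVec, transpose_minArg_mul_mul hG hC]

/-- Expand the nonnegative form of `G` at the deviation of `z` from the minimizer with the same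
constraint value. -/
theorem minCost_le (hG : G.PosDef) (hC : C * W = 1) (z : ι → ℝ) :
    (C *ᵥ z) ⬝ᵥ (minCost G C *ᵥ (C *ᵥ z)) ≤ z ⬝ᵥ (G *ᵥ z) := by
  set Z := minArg G C with hZ
  have h0 := hG.posSemidef.dotProduct_mulVec_nonneg (z - Z *ᵥ (C *ᵥ z))
  have e1 : (Z *ᵥ (C *ᵥ z)) ⬝ᵥ (G *ᵥ z) = (C *ᵥ z) ⬝ᵥ (minCost G C *ᵥ (C *ᵥ z)) := by
    rw [mulVec_dotProduct_eq, mulVec_mulVec, transpose_minArg_mul hG hC, ← mulVec_mulVec]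
  have e2 : z ⬝ᵥ (G *ᵥ (Z *ᵥ (C *ᵥ z))) = (C *ᵥ z) ⬝ᵥ (minCost G C *ᵥ (C *ᵥ z)) := by
    rw [mulVec_mulVec z, mulVec_mulVec, mulVec_mulVec, ← Matrix.mul_assoc, mul_minArg hG,
      ← mulVec_mulVec, ← mulVec_mulVec, dotProduct_mulVec, vecMul_transpose, mulVec_mulVec]
  have e3 := minCost_eq hG hC (C *ᵥ z)
  rw [← hZ] at e3
  simp only [star_trivial, mulVec_sub, dotProduct_sub, sub_dotProduct] at h0
  linarith

theorem tendsto_matrix_inv {u : ℕ → Matrix ι ι ℝ} (hG : IsUnit G)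
    (hu : Filter.Tendsto u Filter.atTop (nhds G)) :
    Filter.Tendsto (fun k => (u k)⁻¹) Filter.atTop (nhds G⁻¹) := by
  simp only [Matrix.inv_def, Ring.inverse_eq_inv']
  have hdet : G.det ≠ 0 := by
    rw [isUnit_iff_isUnit_det] at hG
    exact hG.ne_zero
  have h1 : Filter.Tendsto (fun k => (u k).det) Filter.atTop (nhds G.det) :=
    ((continuous_id.matrix_det).tendsto G).comp hu
  have h2 : Filter.Tendsto (fun k => (u k).adjugate) Filter.atTop (nhds G.adjugate) :=
    ((continuous_id.matrix_adjugate).tendsto G).comp hu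
  exact (h1.inv₀ hdet).smul h2

theorem tendsto_minCost {u : ℕ → Matrix ι ι ℝ} (hG : G.PosDef) (hC : C * W = 1)
    (hu : Filter.Tendsto u Filter.atTop (nhds G)) :
    Filter.Tendsto (fun k => minCost (u k) C) Filter.atTop (nhds (minCost G C)) := by
  refine tendsto_matrix_inv (posDef_mul_inv_mul_transpose hG hC).isUnit ?_
  have h1 : Continuous fun X : Matrix ι ι ℝ => C * X * Cᵀ := by fun_prop
  exact (h1.tendsto G⁻¹).comp (tendsto_matrix_inv hG.isUnit hu)

/-- A sequence of symmetric matrices whose quadratic forms are increasing and pointwise bounded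
converges. -/
theorem exists_tendsto_of_monotone_bounded {u : ℕ → Matrix κ κ ℝ} (hs : ∀ k, (u k)ᵀ = u k)
    (hm : ∀ y, Monotone fun k => y ⬝ᵥ (u k *ᵥ y))
    (hb : ∀ y, ∃ c, ∀ k, y ⬝ᵥ (u k *ᵥ y) ≤ c) :
    ∃ V, Filter.Tendsto u Filter.atTop (nhds V) := by
  have hq : ∀ y, ∃ a, Filter.Tendsto (fun k => y ⬝ᵥ (u k *ᵥ y)) Filter.atTop (nhds a) := by
    intro y
    obtain ⟨c, hc⟩ := hb y
    exact ⟨_, tendsto_atTop_ciSup (hm y) ⟨c, by rintro _ ⟨k, rfl⟩; exact hc k⟩⟩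
  choose q hq using hq
  -- The entries of the limit come from polarizing the limit quadratic form.
  refine ⟨Matrix.of fun i j => (q (Pi.single i 1 + Pi.single j 1) - q (Pi.single i 1)
    - q (Pi.single j 1)) / 2, ?_⟩
  refine tendsto_pi_nhds.2 fun i => tendsto_pi_nhds.2 fun j => ?_
  refine ((((hq (Pi.single i 1 + Pi.single j 1)).sub (hq (Pi.single i 1))).sub
    (hq (Pi.single j 1))).div_const 2).congr fun k => ?_
  have := congrFun (congrFun (hs k) i) j
  simp only [transpose_apply] at this
  simp [mulVec_add, add_dotProduct, this]
  ring

end ConstrainedMinimum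

/-! ### Stein equations and antistable matrices -/

section Sylvester

variable {κ : Type*} [Fintype κ] [DecidableEq κ]

/-- From `N⁻¹X = XM` follows `p(N⁻¹)X = Xp(M)` for every polynomial `p`. For `p` the characteristic
polynomial of `M` the right side vanishes, while `p(N⁻¹)` is invertible because the spectra of `N⁻¹`
and `M` are separated by the unit circle. -/
theorem eq_zero_of_eq_mul_mul {N M X : Matrix κ κ ℂ} (hN : ∀ μ ∈ spectrum ℂ N, 1 < ‖μ‖)
    (hM : ∀ μ ∈ spectrum ℂ M, 1 < ‖μ‖) (h : X = N * X * M) : X = 0 := by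
  have hNu : IsUnit N := by
    by_contra hc
    have := hN 0 (spectrum.zero_mem_iff ℂ |>.2 hc)
    simp at this
    linarith
  obtain ⟨U, rfl⟩ := hNu
  have hinv : (↑U⁻¹ : Matrix κ κ ℂ) * X = X * M := by
    conv_lhs => rw [h]
    rw [Matrix.mul_assoc (U : Matrix κ κ ℂ), ← Matrix.mul_assoc, Units.inv_mul, Matrix.one_mul]
  have hp : ∀ p : Polynomial ℂ, Polynomial.aeval (↑U⁻¹ : Matrix κ κ ℂ) p * X
      = X * Polynomial.aeval M p := by
    intro p
    induction p using Polynomial.induction_on' with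
    | add p q hp hq => rw [map_add, map_add, add_mul, mul_add, hp, hq]
    | monomial k a =>
      have : (↑U⁻¹ : Matrix κ κ ℂ) ^ k * X = X * M ^ k := by
        induction k with
        | zero => simp
        | succ k ih => rw [pow_succ, Matrix.mul_assoc, hinv, ← Matrix.mul_assoc, ih,
            Matrix.mul_assoc, ← pow_succ]
      simp only [Polynomial.aeval_monomial, Algebra.algebraMap_eq_smul_one, Matrix.smul_mul,
        Matrix.one_mul, this, Matrix.mul_smul]
  have hu : IsUnit (Polynomial.aeval (↑U⁻¹ : Matrix κ κ ℂ) M.charpoly) := by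
    by_contra hc
    have hs := (IsAlgClosed.splits M.charpoly).eq_prod_roots_of_monic M.charpoly_monic
    rw [hs] at hc
    obtain ⟨k, hk, hk0⟩ := spectrum.exists_mem_of_not_isUnit_aeval_prod hc
    have h1 := hM k (mem_spectrum_iff_isRoot_charpoly.2 hk0)
    have hkn : k ≠ 0 := by
      rintro rfl
      simp at h1
      linarith
    have h2 := hN k⁻¹ (by
      have := (spectrum.inv_mem_iff (R := ℂ) (r := Units.mk0 k hkn) (a := U⁻¹)).1 hk
      simpa using this)
    rw [norm_inv] at h2
    have := mul_lt_mul'' h1 h2 zero_le_one zero_le_one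
    rw [mul_inv_cancel₀ (by simpa using hkn)] at this
    linarith
  have := hp M.charpoly
  rw [aeval_self_charpoly, Matrix.mul_zero] at this
  exact hu.mul_right_eq_zero.1 this

theorem spectrum_transpose (N : Matrix κ κ ℂ) : spectrum ℂ Nᵀ = spectrum ℂ N := by
  ext μ
  rw [mem_spectrum_iff_isRoot_charpoly, mem_spectrum_iff_isRoot_charpoly, charpoly_transpose]

theorem eq_zero_of_eq_transpose_mul_mul {N M X : Matrix κ κ ℝ}
    (hN : ∀ μ ∈ spectrum ℂ (N.map (fun t : ℝ => (t : ℂ))), 1 < ‖μ‖)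
    (hM : ∀ μ ∈ spectrum ℂ (M.map (fun t : ℝ => (t : ℂ))), 1 < ‖μ‖)
    (h : X = Nᵀ * X * M) : X = 0 := by
  have hc : X.map Complex.ofRealHom = 0 := by
    refine eq_zero_of_eq_mul_mul (N := (N.map Complex.ofRealHom)ᵀ) (M := M.map Complex.ofRealHom)
      (by rw [spectrum_transpose]; exact hN) hM ?_
    conv_lhs => rw [h]
    rw [Matrix.map_mul, Matrix.map_mul, transpose_map]
  ext i j
  simpa using congrFun (congrFun hc i) j

/-- Stein's criterion for antistability. -/
theorem one_lt_norm_of_stein {N V W : Matrix κ κ ℝ} (hV : V.PosDef) (hW : W.PosDef)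
    (h : Nᵀ * V * N = V + W) : ∀ μ ∈ spectrum ℂ (N.map (fun t : ℝ => (t : ℂ))), 1 < ‖μ‖ := by
  intro μ hμ
  have hμ' : Module.End.HasEigenvalue (Matrix.toLin' (N.map (fun t : ℝ => (t : ℂ)))) μ := by
    rw [Module.End.hasEigenvalue_iff_mem_spectrum, Matrix.spectrum_toLin']
    exact hμ
  obtain ⟨z, hz⟩ := hμ'.exists_hasEigenvector
  have hz1 : (N.map (fun t : ℝ => (t : ℂ))) *ᵥ z = μ • z := by
    simpa using hz.apply_eq_smul
  have hz0 : z ≠ 0 := hz.2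
  set a : κ → ℝ := fun i => (z i).re with ha
  set b : κ → ℝ := fun i => (z i).im with hb
  have hNa : N *ᵥ a = μ.re • a - μ.im • b := by
    ext i
    have := congrArg Complex.re (congrFun hz1 i)
    simpa [mulVec, dotProduct, a, b] using this
  have hNb : N *ᵥ b = μ.im • a + μ.re • b := by
    ext i
    have := congrArg Complex.im (congrFun hz1 i)
    simp [mulVec, dotProduct] at this
    simp [mulVec, dotProduct, a, b, this]
    ring
  have key : ∀ x, (N *ᵥ x) ⬝ᵥ (V *ᵥ (N *ᵥ x)) = x ⬝ᵥ (V *ᵥ x) + x ⬝ᵥ (W *ᵥ x) := by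
    intro x
    rw [← dotProduct_add, ← add_mulVec, ← h, ← mulVec_mulVec, ← mulVec_mulVec,
      dotProduct_mulVec x, vecMul_transpose]
  have k1 := key a
  have k2 := key b
  rw [hNa] at k1
  rw [hNb] at k2
  have hab : a ≠ 0 ∨ b ≠ 0 := by
    by_contra hc
    push Not at hc
    apply hz0
    ext i
    exact Complex.ext (congrFun hc.1 i) (congrFun hc.2 i)
  have pos : ∀ {V : Matrix κ κ ℝ}, V.PosDef → 0 < a ⬝ᵥ (V *ᵥ a) + b ⬝ᵥ (V *ᵥ b) := by
    intro V hV
    have h1 := hV.posSemidef.dotProduct_mulVec_nonneg a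
    have h2 := hV.posSemidef.dotProduct_mulVec_nonneg b
    rcases hab with h0 | h0
    · have := hV.dotProduct_mulVec_pos h0
      simp only [star_trivial] at *
      linarith
    · have := hV.dotProduct_mulVec_pos h0
      simp only [star_trivial] at *
      linarith
  simp only [mulVec_sub, mulVec_add, mulVec_smul, dotProduct_sub, sub_dotProduct, dotProduct_add,
    add_dotProduct, dotProduct_smul, smul_dotProduct, smul_eq_mul] at k1 k2
  -- The mixed terms in `a` and `b` cancel when the two real identities are added.
  have hsum : (μ.re ^ 2 + μ.im ^ 2 - 1) * (a ⬝ᵥ (V *ᵥ a) + b ⬝ᵥ (V *ᵥ b))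
      = a ⬝ᵥ (W *ᵥ a) + b ⬝ᵥ (W *ᵥ b) := by
    linear_combination k1 + k2
  have h1 : 0 < μ.re ^ 2 + μ.im ^ 2 - 1 := by
    have := pos hW
    rw [← hsum] at this
    exact pos_of_mul_pos_left this (pos hV).le
  have h2 : 1 < ‖μ‖ ^ 2 := by
    rw [Complex.sq_norm, Complex.normSq_apply]
    linarith
  exact (one_lt_sq_iff₀ (norm_nonneg _)).1 h2

end Sylvester

/-! ### Backward value iteration and its fixed point -/

section ValueIteration

variable {n m : ℕ} {A : Matrix (Fin n) (Fin n) ℝ} {B : Matrix (Fin n) (Fin m) ℝ}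
  {H : Matrix (Fin n ⊕ Fin m) (Fin n ⊕ Fin m) ℝ} {W : Matrix (Fin n ⊕ Fin m) (Fin n) ℝ}

/-- The stage cost `H` plus the quadratic cost `V` of the state. -/
def costAdd (H : Matrix (Fin n ⊕ Fin m) (Fin n ⊕ Fin m) ℝ) (V : Matrix (Fin n) (Fin n) ℝ) :
    Matrix (Fin n ⊕ Fin m) (Fin n ⊕ Fin m) ℝ :=
  H + Matrix.fromBlocks V 0 0 0

theorem dotProduct_costAdd_mulVec (V : Matrix (Fin n) (Fin n) ℝ) (z : Fin n ⊕ Fin m → ℝ) :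
    z ⬝ᵥ (costAdd H V *ᵥ z)
      = z ⬝ᵥ (H *ᵥ z) + (z ∘ Sum.inl) ⬝ᵥ (V *ᵥ (z ∘ Sum.inl)) := by
  rw [costAdd, add_mulVec, dotProduct_add]
  congr 1
  obtain ⟨x, u, rfl⟩ : ∃ x u, z = Sum.elim x u := ⟨_, _, (Sum.elim_comp_inl_inr z).symm⟩
  simp [fromBlocks_mulVec]

theorem costAdd_posDef (hH : H.PosDef) {V : Matrix (Fin n) (Fin n) ℝ} (hV : V.PosSemidef) :
    (costAdd H V).PosDef := by
  refine hH.add_posSemidef (PosSemidef.of_dotProduct_mulVec_nonneg ?_ fun z => ?_)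
  · rw [isHermitian_fromBlocks_iff]
    simpa [IsSymm] using hV.isHermitian.eq
  · have := dotProduct_costAdd_mulVec (H := 0) V z
    have h2 := hV.dotProduct_mulVec_nonneg (z ∘ Sum.inl)
    simp only [costAdd, zero_add, zero_mulVec, dotProduct_zero] at this
    simpa [this] using h2

/-- Value iteration for the cost `H` of steering the system `(A, B)` to a given terminal state from
a free initial state. -/
noncomputable def valueIter (A : Matrix (Fin n) (Fin n) ℝ) (B : Matrix (Fin n) (Fin m) ℝ)
    (H : Matrix (Fin n ⊕ Fin m) (Fin n ⊕ Fin m) ℝ) : ℕ → Matrix (Fin n) (Fin n) ℝ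
  | 0 => 0
  | k + 1 => minCost (costAdd H (valueIter A B H k)) (fromCols A B)

theorem valueIter_posSemidef (hH : H.PosDef) (hC : fromCols A B * W = 1) (k : ℕ) :
    (valueIter A B H k).PosSemidef := by
  induction k with
  | zero => exact PosSemidef.zero
  | succ k ih => exact (minCost_posDef (costAdd_posDef hH ih) hC).posSemidef

theorem valueIter_succ_le (hH : H.PosDef) (hC : fromCols A B * W = 1) (k : ℕ) (x : Fin n → ℝ)
    (u : Fin m → ℝ) :
    (A *ᵥ x + B *ᵥ u) ⬝ᵥ (valueIter A B H (k + 1) *ᵥ (A *ᵥ x + B *ᵥ u))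
      ≤ Sum.elim x u ⬝ᵥ (H *ᵥ Sum.elim x u) + x ⬝ᵥ (valueIter A B H k *ᵥ x) := by
  have := minCost_le (costAdd_posDef hH (valueIter_posSemidef hH hC k)) hC (Sum.elim x u)
  rw [dotProduct_costAdd_mulVec, fromCols_mulVec_sumElim] at this
  exact this

theorem valueIter_mono (hH : H.PosDef) (hC : fromCols A B * W = 1) (y : Fin n → ℝ) :
    Monotone fun k => y ⬝ᵥ (valueIter A B H k *ᵥ y) := by
  refine monotone_nat_of_le_succ fun k => ?_
  induction k generalizing y with
  | zero =>
    have := (valueIter_posSemidef hH hC 1).dotProduct_mulVec_nonneg y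
    simpa [valueIter] using this
  | succ k ih =>
    have hG := costAdd_posDef hH (valueIter_posSemidef hH hC (k + 1))
    rw [show y ⬝ᵥ (valueIter A B H (k + 1 + 1) *ᵥ y) = _ from (minCost_eq hG hC y).symm]
    set z := minArg (costAdd H (valueIter A B H (k + 1))) (fromCols A B) *ᵥ y with hz
    have hCz : fromCols A B *ᵥ z = y := by
      rw [hz, mulVec_mulVec, mul_minArg_eq_one hG hC, one_mulVec]
    -- The minimizer of the later problem is admissible for the earlier one, whose terms are no
    -- larger.
    have h1 := minCost_le (costAdd_posDef hH (valueIter_posSemidef hH hC k)) hC z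
    rw [hCz] at h1
    refine h1.trans ?_
    rw [dotProduct_costAdd_mulVec, dotProduct_costAdd_mulVec]
    exact add_le_add_right (ih _) _

/-- A trajectory from the origin to the given state has a fixed cost, which bounds every iterate.
Here `u 0` is the last input applied. -/
theorem valueIter_bounded_reachable (hH : H.PosDef) (hC : fromCols A B * W = 1) (N : ℕ)
    (u : ℕ → Fin m → ℝ) :
    ∃ c, ∀ k, (∑ p ∈ Finset.range N, (A ^ p * B) *ᵥ u p) ⬝ᵥ
      (valueIter A B H k *ᵥ (∑ p ∈ Finset.range N, (A ^ p * B) *ᵥ u p)) ≤ c := by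
  induction N generalizing u with
  | zero => exact ⟨0, fun k => by simp⟩
  | succ N ih =>
    obtain ⟨c, hc⟩ := ih fun p => u (p + 1)
    set x := ∑ p ∈ Finset.range N, (A ^ p * B) *ᵥ u (p + 1) with hx
    have hsum : ∑ p ∈ Finset.range (N + 1), (A ^ p * B) *ᵥ u p = A *ᵥ x + B *ᵥ u 0 := by
      rw [Finset.sum_range_succ', hx, mulVec_sum]
      simp [mulVec_mulVec, pow_succ', Matrix.mul_assoc]
    rw [hsum]
    refine ⟨Sum.elim x (u 0) ⬝ᵥ (H *ᵥ Sum.elim x (u 0)) + c, fun k => ?_⟩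
    exact (valueIter_mono hH hC _ (Nat.le_succ k)).trans
      ((valueIter_succ_le hH hC k x (u 0)).trans (add_le_add_right (hc k) _))

theorem IsControllable.exists_sum_eq (h : IsControllable A B) (y : Fin n → ℝ) :
    ∃ u : ℕ → Fin m → ℝ, ∑ p ∈ Finset.range n, (A ^ p * B) *ᵥ u p = y := by
  set M := Matrix.of fun (i : Fin n) (p : Fin n × Fin m) => (A ^ (p.1 : ℕ) * B) i p.2 with hM
  have hr : LinearMap.range M.mulVecLin = ⊤ := by
    apply Submodule.eq_top_of_finrank_eq
    rw [Module.finrank_fin_fun]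
    exact h
  obtain ⟨w, hw⟩ := LinearMap.range_eq_top.1 hr y
  refine ⟨fun p j => if hp : p < n then w (⟨p, hp⟩, j) else 0, ?_⟩
  rw [← hw, Finset.sum_range]
  ext i
  simp [M, mulVec, dotProduct, Fintype.sum_prod_type, Finset.sum_apply]

theorem exists_posDef_eq_minCost (hH : H.PosDef) (hC : fromCols A B * W = 1)
    (h : IsControllable A B) :
    ∃ V : Matrix (Fin n) (Fin n) ℝ, V.PosDef ∧ V = minCost (costAdd H V) (fromCols A B) := by
  have hb : ∀ y, ∃ c, ∀ k, y ⬝ᵥ (valueIter A B H k *ᵥ y) ≤ c := by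
    intro y
    obtain ⟨u, rfl⟩ := h.exists_sum_eq y
    exact valueIter_bounded_reachable hH hC n u
  obtain ⟨V, hV⟩ := exists_tendsto_of_monotone_bounded
    (fun k => by simpa using (valueIter_posSemidef hH hC k).isHermitian.eq)
    (valueIter_mono hH hC) hb
  have hVs : V.PosSemidef := by
    refine PosSemidef.of_dotProduct_mulVec_nonneg ?_ fun y => ?_
    · have hc : Continuous fun X : Matrix (Fin n) (Fin n) ℝ => Xᴴ := by fun_prop
      refine tendsto_nhds_unique ((hc.tendsto V).comp hV) (hV.congr fun k => ?_)
      exact (valueIter_posSemidef hH hC k).isHermitian.eq.symm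
    · have hc : Continuous fun X : Matrix (Fin n) (Fin n) ℝ => star y ⬝ᵥ (X *ᵥ y) := by fun_prop
      exact ge_of_tendsto' ((hc.tendsto V).comp hV) fun k =>
        (valueIter_posSemidef hH hC k).dotProduct_mulVec_nonneg y
  have hG := costAdd_posDef hH hVs
  have hc : Continuous fun X : Matrix (Fin n) (Fin n) ℝ => costAdd H X := by
    unfold costAdd
    fun_prop
  have hfix : V = minCost (costAdd H V) (fromCols A B) :=
    tendsto_nhds_unique (hV.comp (Filter.tendsto_add_atTop_nat 1))
      (tendsto_minCost hG hC ((hc.tendsto V).comp hV))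
  -- The limit is a priori only semidefinite; being a `minCost` makes it definite.
  exact ⟨V, hfix ▸ minCost_posDef hG hC, hfix⟩

end ValueIteration

/-! ### Existence, uniqueness and rotation for the DARE -/

section Riccati

variable {n m : ℕ} {A : Matrix (Fin n) (Fin n) ℝ} {B : Matrix (Fin n) (Fin m) ℝ}
  {Q : Matrix (Fin n) (Fin n) ℝ} {S : Matrix (Fin m) (Fin n) ℝ} {R : Matrix (Fin m) (Fin m) ℝ}

theorem mul_dareGain {P : Matrix (Fin n) (Fin n) ℝ} (h : IsUnit (R + Bᵀ * P * B)) :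
    (R + Bᵀ * P * B) * dareGain A B S R P = S + Bᵀ * P * A := by
  rw [isUnit_iff_isUnit_det] at h
  rw [dareGain, ← Matrix.mul_assoc, Matrix.mul_nonsing_inv _ h, Matrix.one_mul]

/-- Subtracting `Kᵀ` times the second equation from the first gives `v = A_K⁻ᵀS_Kᵀu`; substituted
into the second, this reads `Dᵀu = 0`. In effect `D` is a Schur complement of the block matrix `[A
B; S R]` after a column operation. -/
theorem eq_zero_of_isUnit_sub {K : Matrix (Fin m) (Fin n) ℝ} (hR : R.IsSymm)
    (hAK : IsUnit (A - B * K)) (hD : IsUnit (R - (S - R * K) * (A - B * K)⁻¹ * B))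
    {u : Fin m → ℝ} {v : Fin n → ℝ} (h1 : Sᵀ *ᵥ u = Aᵀ *ᵥ v) (h2 : R *ᵥ u = Bᵀ *ᵥ v) : u = 0 := by
  have hAK' := (isUnit_iff_isUnit_det _).1 hAK
  have e1 : (S - R * K)ᵀ *ᵥ u = (A - B * K)ᵀ *ᵥ v := by
    simp only [transpose_sub, transpose_mul, sub_mulVec, ← mulVec_mulVec, hR.eq, h1, h2]
  have e2 : u ᵥ* (R - (S - R * K) * (A - B * K)⁻¹ * B) = 0 := by
    rw [vecMul_sub, ← vecMul_vecMul, ← vecMul_vecMul, ← mulVec_transpose (S - R * K), e1,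
      mulVec_transpose, vecMul_vecMul v, Matrix.mul_nonsing_inv _ hAK', vecMul_one,
      ← mulVec_transpose, ← mulVec_transpose, hR.eq, h2, sub_self]
  exact vecMul_injective_iff_isUnit.2 hD (by simpa using e2)

theorem isUnit_of_forall_mulVec {k : ℕ} {M : Matrix (Fin k) (Fin k) ℝ}
    (h : ∀ v, M *ᵥ v = 0 → v = 0) : IsUnit M := by
  rw [← mulVec_injective_iff_isUnit]
  exact (injective_iff_map_eq_zero M.mulVecLin).2 h

/-- Existence of the antistabilizing solution for a positive definite stage cost. -/
theorem exists_antistabilizing_of_posDef (hR : R.IsSymm) (hctrl : IsControllable A B)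
    (hH : (fromBlocks Q Sᵀ S R).PosDef) (K : Matrix (Fin m) (Fin n) ℝ) (hAK : IsUnit (A - B * K))
    (hD : IsUnit (R - (S - R * K) * (A - B * K)⁻¹ * B)) :
    ∃ P : Matrix (Fin n) (Fin n) ℝ, IsAntistabilizingDARESolution A B Q S R P := by
  -- The feedback `u = -Kx` reaches any state in one step, so the constraint is always feasible.
  have hC : fromCols A B * fromRows (A - B * K)⁻¹ (-(K * (A - B * K)⁻¹)) = 1 := by
    rw [fromCols_mul_fromRows, Matrix.mul_neg, ← Matrix.mul_assoc, ← sub_eq_add_neg,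
      ← Matrix.sub_mul, Matrix.mul_nonsing_inv _ ((isUnit_iff_isUnit_det _).1 hAK)]
  obtain ⟨V, hV, hfix⟩ := exists_posDef_eq_minCost hH hC hctrl
  have hVs : Vᵀ = V := isSymm_of_posDef hV
  have hG := costAdd_posDef hH hV.posSemidef
  have hGe : costAdd (fromBlocks Q Sᵀ S R) V = fromBlocks (Q + V) Sᵀ S R := by
    simp [costAdd, fromBlocks_add]
  have hCZ := mul_minArg_eq_one hG hC
  have hGZ := mul_minArg (C := fromCols A B) hG
  have hZGZ := transpose_minArg_mul_mul hG hC
  rw [← hfix] at hGZ hZGZ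
  generalize minArg (costAdd (fromBlocks Q Sᵀ S R) V) (fromCols A B) = Z at hCZ hGZ hZGZ
  obtain ⟨F, U, rfl⟩ : ∃ F U, Z = fromRows F U := ⟨_, _, (fromRows_toRows Z).symm⟩
  rw [fromCols_mul_fromRows] at hCZ
  rw [hGe, fromBlocks_mul_fromRows, transpose_fromCols, fromRows_mul] at hGZ
  obtain ⟨hx, hu⟩ := fromRows_inj hGZ
  have hFu : IsUnit F := by
    refine isUnit_of_forall_mulVec fun y hy => ?_
    have hy1 : B *ᵥ (U *ᵥ y) = y := by
      have := congrArg (· *ᵥ y) hCZ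
      simpa [add_mulVec, ← mulVec_mulVec, hy] using this
    have : U *ᵥ y = 0 := by
      refine eq_zero_of_isUnit_sub (v := V *ᵥ y) hR hAK hD ?_ ?_
      · have := congrArg (· *ᵥ y) hx
        simpa [add_mulVec, ← mulVec_mulVec, hy] using this
      · have := congrArg (· *ᵥ y) hu
        simpa [add_mulVec, ← mulVec_mulVec, hy] using this
    rw [← hy1, this, mulVec_zero]
  have hF := (isUnit_iff_isUnit_det _).1 hFu
  have cancel : ∀ {k : ℕ} {X Y : Matrix (Fin k) (Fin n) ℝ}, X * F = Y * F → X = Y := by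
    intro k X Y h
    have := congrArg (· * F⁻¹) h
    simpa [Matrix.mul_assoc, Matrix.mul_nonsing_inv _ hF] using this
  have hMK : (R + Bᵀ * -V * B) * -(U * F⁻¹) = S + Bᵀ * -V * A := by
    refine cancel ?_
    rw [Matrix.mul_assoc, Matrix.neg_mul, Matrix.mul_assoc U, Matrix.nonsing_inv_mul _ hF,
      Matrix.mul_one]
    have hBU : B * U = 1 - A * F := eq_sub_of_add_eq' hCZ
    have hRU : R * U = Bᵀ * V - S * F := eq_sub_of_add_eq' hu
    simp only [Matrix.mul_neg, Matrix.neg_mul, Matrix.add_mul, Matrix.mul_assoc, hBU, hRU,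
      Matrix.mul_sub, Matrix.mul_one]
    abel
  have hM : IsUnit (R + Bᵀ * -V * B) := by
    refine isUnit_of_forall_mulVec fun u h => ?_
    have h' : u ᵥ* (R + Bᵀ * -V * B) = 0 := by
      rw [← mulVec_transpose]
      simpa [hR.eq, hVs, Matrix.mul_assoc] using h
    -- By `hMK`, a left kernel vector of `R - BᵀVB` also annihilates `S - BᵀVA`.
    have h2 : u ᵥ* (S + Bᵀ * -V * A) = 0 := by
      rw [← hMK, ← vecMul_vecMul, h', zero_vecMul]
    refine eq_zero_of_isUnit_sub (v := V *ᵥ (B *ᵥ u)) hR hAK hD ?_ ?_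
    · rw [← mulVec_transpose] at h2
      have : Sᵀ *ᵥ u + -(Aᵀ *ᵥ (V *ᵥ (B *ᵥ u))) = 0 := by
        simpa [hVs, Matrix.mul_assoc, add_mulVec, neg_mulVec, mulVec_mulVec] using h2
      exact eq_of_sub_eq_zero (by rwa [sub_eq_add_neg])
    · have : R *ᵥ u + -(Bᵀ *ᵥ (V *ᵥ (B *ᵥ u))) = 0 := by
        simpa [Matrix.mul_assoc, add_mulVec, neg_mulVec, mulVec_mulVec] using h
      exact eq_of_sub_eq_zero (by rwa [sub_eq_add_neg])
  have hgain : dareGain A B S R (-V) = -(U * F⁻¹) := by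
    rw [dareGain, ← hMK, ← Matrix.mul_assoc,
      Matrix.nonsing_inv_mul _ ((isUnit_iff_isUnit_det _).1 hM), Matrix.one_mul]
  have hloop : A - B * -(U * F⁻¹) = F⁻¹ := by
    refine cancel ?_
    rw [Matrix.nonsing_inv_mul _ hF, ← hCZ, Matrix.mul_neg, sub_neg_eq_add, Matrix.add_mul,
      Matrix.mul_assoc B, Matrix.mul_assoc U, Matrix.nonsing_inv_mul _ hF, Matrix.mul_one]
  refine ⟨-V, ⟨by simp [IsSymm, hVs], hM, ?_⟩, ?_⟩
  · rw [hgain]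
    refine cancel ?_
    have hBU : B * U = 1 - A * F := eq_sub_of_add_eq' hCZ
    have hSU : Sᵀ * U = Aᵀ * V - (Q + V) * F := eq_sub_of_add_eq' hx
    simp only [Matrix.mul_neg, Matrix.neg_mul, Matrix.add_mul, Matrix.sub_mul, Matrix.mul_assoc,
      Matrix.nonsing_inv_mul _ hF, Matrix.mul_one, hBU, hSU, Matrix.mul_sub]
    abel
  · rw [hgain, hloop]
    have hT : Function.Injective (fromRows (1 : Matrix (Fin n) (Fin n) ℝ) (U * F⁻¹)).mulVec := by
      intro x y h
      rw [fromRows_mulVec, fromRows_mulVec, one_mulVec, one_mulVec] at h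
      exact (Sum.elim_eq_iff.1 h).1
    refine one_lt_norm_of_stein hV (hH.conjTranspose_mul_mul_same hT) ?_
    have hZF : fromRows F U * F⁻¹ = fromRows 1 (U * F⁻¹) := by
      rw [fromRows_mul, Matrix.mul_nonsing_inv _ hF]
    have : (F⁻¹)ᵀ * V * F⁻¹ = (fromRows F U * F⁻¹)ᵀ * costAdd (fromBlocks Q Sᵀ S R) V
        * (fromRows F U * F⁻¹) := by
      rw [transpose_mul]
      conv_lhs => rw [← hZGZ]
      simp only [Matrix.mul_assoc]
    rw [this, hZF, costAdd, Matrix.mul_add, Matrix.add_mul, add_comm V]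
    congr 1
    rw [transpose_fromRows, fromCols_mul_fromBlocks, fromCols_mul_fromRows]
    simp

theorem IsAntistabilizingDARESolution.eq (hQ : Q.IsSymm) (hR : R.IsSymm)
    {P₁ P₂ : Matrix (Fin n) (Fin n) ℝ}
    (h₁ : IsAntistabilizingDARESolution A B Q S R P₁)
    (h₂ : IsAntistabilizingDARESolution A B Q S R P₂) : P₁ = P₂ := by
  have g₁ := mul_dareGain (A := A) (S := S) h₁.solution.isUnit
  have g₂ := mul_dareGain (A := A) (S := S) h₂.solution.isUnit
  have e₁ := h₁.solution.eq
  have e₂ := h₂.solution.eq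
  have o₁ := h₁.outside
  have o₂ := h₂.outside
  have s₁ := h₁.solution.symm.eq
  generalize dareGain A B S R P₁ = K₁ at *
  generalize dareGain A B S R P₂ = K₂ at *
  have t₁ := congrArg transpose e₁
  have t₂ := congrArg transpose g₁
  simp only [transpose_sub, transpose_add, transpose_mul, transpose_transpose, s₁, hQ.eq,
    hR.eq] at t₁ t₂
  rw [← sub_eq_zero]
  refine eq_zero_of_eq_transpose_mul_mul o₁ o₂ ?_
  -- For both solutions the sandwiched matrix equals `Pᵢ` plus the same term `-Q + K₁ᵀS + SᵀK₂ -
  -- K₁ᵀRK₂`, which drops out of the difference.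
  have i₁ : (A - B * K₁)ᵀ * P₁ * (A - B * K₂) = P₁ - Q + K₁ᵀ * S + (Sᵀ - K₁ᵀ * R) * K₂ := by
    have hB : Aᵀ * P₁ * B = K₁ᵀ * (R + Bᵀ * P₁ * B) - Sᵀ := by
      rw [Matrix.mul_assoc Aᵀ, Matrix.mul_assoc Bᵀ]
      exact eq_sub_of_add_eq' t₂.symm
    have hA : P₁ - Q + K₁ᵀ * S = Aᵀ * P₁ * A - K₁ᵀ * (Bᵀ * P₁ * A) := by
      conv_lhs => rw [t₁]
      simp only [Matrix.mul_add, Matrix.mul_assoc]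
      abel
    calc _ = Aᵀ * P₁ * A - K₁ᵀ * (Bᵀ * P₁ * A) - (Aᵀ * P₁ * B) * K₂ + K₁ᵀ * (Bᵀ * P₁ * B) * K₂ := by
          simp only [transpose_sub, transpose_mul, Matrix.mul_sub, Matrix.sub_mul, Matrix.mul_assoc]
          abel
      _ = _ := by
          rw [hA, hB]
          simp only [Matrix.mul_add, Matrix.add_mul, Matrix.sub_mul, Matrix.mul_assoc]
          abel
  have i₂ : (A - B * K₁)ᵀ * P₂ * (A - B * K₂) = P₂ - Q + Sᵀ * K₂ + K₁ᵀ * (S - R * K₂) := by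
    have hB : Bᵀ * P₂ * A = (R + Bᵀ * P₂ * B) * K₂ - S := eq_sub_of_add_eq' g₂.symm
    have hA : P₂ - Q + Sᵀ * K₂ = Aᵀ * P₂ * A - Aᵀ * P₂ * B * K₂ := by
      conv_lhs => rw [e₂]
      simp only [Matrix.add_mul]
      abel
    calc _ = Aᵀ * P₂ * A - Aᵀ * P₂ * B * K₂ - K₁ᵀ * (Bᵀ * P₂ * A) + K₁ᵀ * (Bᵀ * P₂ * B * K₂) := by
          simp only [transpose_sub, transpose_mul, Matrix.mul_sub, Matrix.sub_mul, Matrix.mul_assoc]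
          abel
      _ = _ := by
          rw [hA, hB]
          simp only [Matrix.mul_sub, Matrix.mul_add, Matrix.add_mul, Matrix.mul_assoc]
          abel
  rw [Matrix.mul_sub (A - B * K₁)ᵀ, Matrix.sub_mul, i₁, i₂]
  simp only [Matrix.mul_sub, Matrix.sub_mul, Matrix.mul_assoc]
  abel

theorem QuadStrictPreDissipative.exists_symm_posDef (hQ : Q.IsSymm) (hR : R.IsSymm)
    (h : QuadStrictPreDissipative A B Q S R) :
    ∃ L : Matrix (Fin n) (Fin n) ℝ, Lᵀ = L ∧ (rotatedCost A B Q S R L).PosDef := by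
  obtain ⟨L, ε, hε, h⟩ := h
  set L' := (1 / 2 : ℝ) • (L + Lᵀ) with hL'
  have hs : L'ᵀ = L' := by simp [hL', add_comm]
  refine ⟨L', hs, PosDef.of_dotProduct_mulVec_pos ?_ fun z hz => ?_⟩
  · rw [IsHermitian, conjTranspose_eq_transpose_of_trivial, rotatedCost, fromBlocks_transpose]
    simp [hs, hQ.eq, hR.eq, Matrix.mul_assoc]
  · obtain ⟨x, u, rfl⟩ : ∃ x u, z = Sum.elim x u := ⟨_, _, (Sum.elim_comp_inl_inr z).symm⟩
    have expand : ∀ N : Matrix (Fin n) (Fin n) ℝ,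
        Sum.elim x u ⬝ᵥ (rotatedCost A B Q S R N *ᵥ Sum.elim x u)
          = x ⬝ᵥ (Q *ᵥ x) + 2 * (u ⬝ᵥ (S *ᵥ x)) + u ⬝ᵥ (R *ᵥ u) + x ⬝ᵥ (N *ᵥ x)
            - (A *ᵥ x + B *ᵥ u) ⬝ᵥ (N *ᵥ (A *ᵥ x + B *ᵥ u)) := by
      intro N
      have hS : x ⬝ᵥ (Sᵀ *ᵥ u) = u ⬝ᵥ (S *ᵥ x) := by
        rw [← mulVec_dotProduct_eq, dotProduct_comm]
      simp only [rotatedCost, fromBlocks_mulVec, Sum.elim_comp_inl, Sum.elim_comp_inr,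
        sumElim_dotProduct_sumElim, add_mulVec, sub_mulVec, dotProduct_add, dotProduct_sub,
        add_dotProduct, mulVec_add, mulVec_dotProduct_eq, mulVec_mulVec, hS, Matrix.mul_assoc]
      ring
    have hLx : ∀ w : Fin n → ℝ, w ⬝ᵥ (L' *ᵥ w) = w ⬝ᵥ (L *ᵥ w) := by
      intro w
      have : w ⬝ᵥ (Lᵀ *ᵥ w) = w ⬝ᵥ (L *ᵥ w) := by
        rw [← mulVec_dotProduct_eq, dotProduct_comm]
      simp only [hL', smul_mulVec, add_mulVec, dotProduct_smul, dotProduct_add, this, smul_eq_mul]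
      ring
    have hx := h x u
    rw [expand] at hx
    rw [star_trivial, expand, hLx, hLx]
    refine lt_of_lt_of_le (mul_pos hε ?_) hx
    have := dotProduct_star_self_pos_iff.2 hz
    simpa using this

theorem IsAntistabilizingDARESolution.of_rotated {L P : Matrix (Fin n) (Fin n) ℝ} (hL : Lᵀ = L)
    (h : IsAntistabilizingDARESolution A B (Q + L - Aᵀ * L * A) (S - Bᵀ * L * A) (R - Bᵀ * L * B)
      P) : IsAntistabilizingDARESolution A B Q S R (P - L) := by
  have hM : R + Bᵀ * (P - L) * B = R - Bᵀ * L * B + Bᵀ * P * B := by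
    simp only [Matrix.mul_sub, Matrix.sub_mul]
    abel
  have hN : S + Bᵀ * (P - L) * A = S - Bᵀ * L * A + Bᵀ * P * A := by
    simp only [Matrix.mul_sub, Matrix.sub_mul]
    abel
  have hK : dareGain A B S R (P - L) = dareGain A B (S - Bᵀ * L * A) (R - Bᵀ * L * B) P := by
    rw [dareGain, dareGain, hM, hN]
  refine ⟨⟨?_, hM ▸ h.solution.isUnit, ?_⟩, hK ▸ h.outside⟩
  · rw [IsSymm, transpose_sub, hL, h.solution.symm.eq]
  · rw [hK]
    conv_lhs => rw [h.solution.eq]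
    simp only [transpose_sub, transpose_mul, transpose_transpose, hL, Matrix.mul_sub,
      Matrix.sub_mul, Matrix.add_mul, Matrix.mul_assoc]
    abel

end Riccati

theorem mainTheorem6 {n m : ℕ}
    (A : Matrix (Fin n) (Fin n) ℝ) (B : Matrix (Fin n) (Fin m) ℝ)
    (Q : Matrix (Fin n) (Fin n) ℝ) (S : Matrix (Fin m) (Fin n) ℝ)
    (R : Matrix (Fin m) (Fin m) ℝ)
    (hQ : Q.IsSymm) (hR : R.IsSymm)
    (hctrl : IsControllable A B)
    (hdiss : QuadStrictPreDissipative A B Q S R)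
    (K : Matrix (Fin m) (Fin n) ℝ)
    (hAK : IsUnit (A - B * K))
    (hD : IsUnit (R - (S - R * K) * (A - B * K)⁻¹ * B)) :
    ∃! P : Matrix (Fin n) (Fin n) ℝ, IsAntistabilizingDARESolution A B Q S R P := by
  obtain ⟨L, hL, hH⟩ := hdiss.exists_symm_posDef hQ hR
  have hS' : (S - Bᵀ * L * A)ᵀ = Sᵀ - Aᵀ * L * B := by
    simp [hL, Matrix.mul_assoc]
  rw [rotatedCost, ← hS'] at hH
  have hR' : (R - Bᵀ * L * B).IsSymm := by
    simp [IsSymm, hL, hR.eq, Matrix.mul_assoc]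
  -- Rotation leaves `D` unchanged: the shift `-BᵀLA_K` of `S_K` contributes `BᵀLB`, cancelling the
  -- shift of `R`.
  have hD' : IsUnit (R - Bᵀ * L * B -
      (S - Bᵀ * L * A - (R - Bᵀ * L * B) * K) * (A - B * K)⁻¹ * B) := by
    have e : S - Bᵀ * L * A - (R - Bᵀ * L * B) * K = S - R * K - Bᵀ * L * (A - B * K) := by
      simp only [Matrix.mul_sub, Matrix.sub_mul, Matrix.mul_assoc]
      abel
    rw [e, Matrix.sub_mul, Matrix.mul_assoc (Bᵀ * L),
      Matrix.mul_nonsing_inv _ ((isUnit_iff_isUnit_det _).1 hAK), Matrix.mul_one, Matrix.sub_mul]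
    convert hD using 1
    abel
  obtain ⟨P, hP⟩ := exists_antistabilizing_of_posDef hR' hctrl hH K hAK hD'
  exact ⟨P - L, hP.of_rotated hL, fun P' hP' => hP'.eq hQ hR (hP.of_rotated hL)⟩
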